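/- **Definitions.** A ranked set is a set $C$ with a function $rank:C\to\mathbb N$. A (finite) hypergraph $G$ over $C$ consists of a finite set $V_G$ of nodes, a finite set $E_G$ of hyperedges, for each $e\in E_G$ a string $att_G(e)$ of pairwise distinct nodes and a label $lab_G(e)\in C$ with $rank(lab_G(e))=|att_G(e)|$, and a string $ext_G$ of pairwise distinct (external) nodes; $rank(e)=|att_G(e)|$, $rank(G)=|ext_G|$, and $\mathcal H(C)$ is the set of all hypergraphs over $C$. Isomorphic hypergraphs are not distinguished. If $rank(e)=rank(H)$, then $G[e/H]$ is obtained from $G$ by removing $e$, adding a disjoint copy of $H$ and fusing, for each $i$, the $i$-th external node of $H$ with the $i$-th attachment node of $e$; $G[e_1/H_1,\dots,e_k/H_k]$ denotes simultaneous replacement of distinct hyperedges, and $G[e:=a]$ is $G$ with the hyperedge $e$ relabeled by $a$. The handle $a^\bullet$ has $rank(a)$ nodes $v_1,\dots,v_n$, $ext=v_1\dots v_n$ and one hyperedge, labeled by $a$ and attached to $v_1\dots v_n$. Let $Pr$ be a countable ranked set with infinitely many elements of each rank. The *types* are defined inductively: each $p\in Pr$ is a type; if $N$ is a type and $D$ is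 a hypergraph with $rank(D)=rank(N)$ in which exactly one hyperedge $d_0$ is labeled by the special symbol $\$$ (of any rank) and all others (possibly none) are labeled by types, then $N\div D$ is a type of rank $rank(d_0)$; if $M$ is a hypergraph whose hyperedges (possibly none) are labeled by types, then $\times(M)$ is a type of rank $rank(M)$. A *sequent* $H\to A$ consists of a hypergraph $H$ labeled by types and a type $A$ with $rank(H)=rank(A)$. The *hypergraph Lambek calculus* $\mathrm{HL}$ has the axioms $p^\bullet\to p$ ($p\in Pr$) and the following rules, where $d_0$ is the $\$$-labeled hyperedge of $D$, its other hyperedges are $d_1,\dots,d_k$ with labels $T_1,\dots,T_k$, and $M$ has hyperedges $m_1,\dots,m_l$: * $(\div\to)$: from $H\to A$ and $H_i\to T_i$ ($1\le i\le k$) infer $H[e/D][d_0:=N\div D][d_1/H_1,\dots,d_k/H_k]\to A$, where $e\in E_H$ is labeled by $N$; * $(\to\div)$: from $D[d_0/F]\to N$ infer $F\to N\div D$; * $(\times\to)$: from $G[e/F]\to A$ infer $G\to A$, where $e\in E_G$ is labeled by $\times(F)$; * $(\to\times)$: from $H_j\to lab_M(m_j)$ ($1\le j\le l$) infer $M[m_1/H_1,\dots,m_l/H_l]\to\times(M)$.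 We write $\mathrm{HL}\vdash H\to A$ if $H\to A$ is derivable. Given a ranked alphabet $\Sigma$ (a ranked set, possibly infinite), a *valuation* is a function $w:Pr\to\mathcal P(\mathcal H(\Sigma))$ such that $rank(G)=rank(p)$ for all $G\in w(p)$. It extends to all types by $\overline w(p)=w(p)$; $$\overline w(N\div D)=\{G\in\mathcal H(\Sigma) : rank(G)=rank(N\div D),\ D[d_0/G,d_1/H_1,\dots,d_k/H_k]\in\overline w(N)\text{ for all }H_i\in\overline w(T_i)\};$$ $$\overline w(\times(M))=\{M[m_1/H_1,\dots,m_l/H_l] : H_j\in\overline w(lab_M(m_j))\}.$$ The statement $\overline w(H\to A)$ means $\overline w(\times(H))\subseteq\overline w(A)$. **Theorem (completeness of the product-free fragment).** Let $H\to A$ be a sequent such that neither $A$ nor the labels of $H$ contain $\times$ (at any depth). If $\overline w(H\to A)$ is true for each ranked alphabet $\Sigma$ and each valuation $w:Pr\to\mathcal P(\mathcal H(\Sigma))$, then $\mathrm{HL}\vdash H\to A$. -/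

import Mathlib

/-! A ranked set is given as a family `C : ℕ → Type`, where `C n` is the set of its elements of
rank `n`. A string of length `n` of pairwise distinct elements of `V` is an embedding
`Fin n ↪ V`. -/

namespace HL

/-- The unlabeled part of a hypergraph of rank `r` with node set `V` and hyperedge set `E`:
`ar e` is the rank of `e`, `att e` is the string of (distinct) attachment nodes of `e`, and `ext`
is the string of (distinct) external nodes. -/
structure Skeleton (V E : Type) (r : ℕ) : Type where
  ar : E → ℕ
  att : ∀ e, Fin (ar e) ↪ V
  ext : Fin r ↪ V

/-- The skeleton with one more hyperedge `none`, attached to the nodes `d`. -/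
def Skeleton.insertEdge {V E : Type} {r q : ℕ} (S : Skeleton V E r) (d : Fin q ↪ V) :
    Skeleton V (Option E) r where
  ar := fun e => match e with
    | none => q
    | some e => S.ar e
  att := fun e => match e with
    | none => d
    | some e => S.att e
  ext := S.ext

/-- Isomorphisms of skeletons. -/
structure Skeleton.Iso {V E V' E' : Type} {r : ℕ} (S : Skeleton V E r) (S' : Skeleton V' E' r) where
  node : V ≃ V'
  edge : E ≃ E'
  ar_eq : ∀ e, S'.ar (edge e) = S.ar e
  att_eq : ∀ e (i : Fin (S.ar e)), S'.att (edge e) (Fin.cast (ar_eq e).symm i) = node (S.att e i)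
  ext_eq : ∀ i, S'.ext i = node (S.ext i)

/-- (Finite) hypergraphs of rank `r` with labels from the ranked set `C`; the rank of a label is
the number of attachment nodes of the hyperedge. -/
structure HGraph (C : ℕ → Type) (r : ℕ) where
  V : Type
  E : Type
  finV : Finite V
  finE : Finite E
  skel : Skeleton V E r
  lab : ∀ e, C (skel.ar e)

/-- `G` and `G'` are isomorphic, where corresponding labels have to be related by `R`. -/
def HGraph.IsoUpTo {C : ℕ → Type} (R : ∀ {n : ℕ}, C n → C n → Prop) {r : ℕ}
    (G G' : HGraph C r) : Prop :=
  ∃ f : Skeleton.Iso G.skel G'.skel, ∀ e, R (G.lab e) (f.ar_eq e ▸ G'.lab (f.edge e))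

/-- Isomorphism of labeled hypergraphs. -/
def HGraph.Isom {C : ℕ → Type} {r : ℕ} (G G' : HGraph C r) : Prop :=
  HGraph.IsoUpTo (fun a b => a = b) G G'

/-- The handle of a label `a`. -/
abbrev handle {C : ℕ → Type} {r : ℕ} (a : C r) : HGraph C r where
  V := Fin r
  E := Unit
  finV := inferInstance
  finE := inferInstance
  skel := ⟨fun _ => r, fun _ => Function.Embedding.refl _, Function.Embedding.refl _⟩
  lab := fun _ => a

section Subst

variable {C : ℕ → Type} {V E : Type} {r : ℕ}

/-- Nodes of the hypergraph obtained by replacing each hyperedge `e` by `F e`: the nodes of the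
host and the non-external nodes of all the `F e`. -/
abbrev SubstNode (S : Skeleton V E r) (F : ∀ e, HGraph C (S.ar e)) : Type :=
  V ⊕ (Σ e : E, {v : (F e).V // ¬ ∃ i, (F e).skel.ext i = v})

open Classical in
/-- Image of a node of `F e` in the result: the `i`-th external node is fused with the `i`-th
attachment node of `e`. -/
noncomputable def substNode (S : Skeleton V E r) (F : ∀ e, HGraph C (S.ar e)) (e : E)
    (v : (F e).V) : SubstNode S F :=
  if h : ∃ i, (F e).skel.ext i = v then Sum.inl (S.att e h.choose) else Sum.inr ⟨e, v, h⟩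

theorem substNode_ext (S : Skeleton V E r) (F : ∀ e, HGraph C (S.ar e)) (e : E)
    (i : Fin (S.ar e)) : substNode S F e ((F e).skel.ext i) = Sum.inl (S.att e i) := by
  have h : ∃ j, (F e).skel.ext j = (F e).skel.ext i := ⟨i, rfl⟩
  have h2 : h.choose = i := (F e).skel.ext.injective h.choose_spec
  unfold substNode
  rw [dif_pos h, h2]

theorem substNode_injective (S : Skeleton V E r) (F : ∀ e, HGraph C (S.ar e)) (e : E) :
    Function.Injective (substNode S F e) := by
  intro v v' hv
  by_cases h : ∃ i, (F e).skel.ext i = v <;> by_cases h' : ∃ i, (F e).skel.ext i = v'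
  · obtain ⟨i, rfl⟩ := h
    obtain ⟨j, rfl⟩ := h'
    rw [substNode_ext, substNode_ext] at hv
    rw [(S.att e).injective (Sum.inl.inj hv)]
  · simp [substNode, h, h'] at hv
  · simp [substNode, h, h'] at hv
  · simpa [substNode, h, h'] using hv

/-- Simultaneous replacement of all hyperedges: each hyperedge `e` of the skeleton `S` is replaced
by the hypergraph `F e`. -/
noncomputable def Skeleton.subst [Finite V] [Finite E] (S : Skeleton V E r)
    (F : ∀ e, HGraph C (S.ar e)) : HGraph C r where
  V := SubstNode S F
  E := Σ e : E, (F e).E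
  finV := by
    have := fun e => (F e).finV
    infer_instance
  finE := by
    have := fun e => (F e).finE
    infer_instance
  skel :=
    { ar := fun x => (F x.1).skel.ar x.2
      att := fun x => ((F x.1).skel.att x.2).trans ⟨substNode S F x.1, substNode_injective S F x.1⟩
      ext := S.ext.trans ⟨Sum.inl, Sum.inl_injective⟩ }
  lab := fun x => (F x.1).lab x.2

end Subst

/-- Simultaneous replacement of all hyperedges of a hypergraph. -/
noncomputable def HGraph.subst {C C' : ℕ → Type} {r : ℕ} (H : HGraph C r)
    (F : ∀ e : H.E, HGraph C' (H.skel.ar e)) : HGraph C' r :=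
  haveI := H.finV
  haveI := H.finE
  H.skel.subst F

open Classical in
/-- Replacement `H[e/G]` of one hyperedge; the other hyperedges stay as they are, that is, each of
them is replaced by the handle of its own label. -/
noncomputable def HGraph.replace {C : ℕ → Type} {r : ℕ} (H : HGraph C r) (e : H.E)
    (G : HGraph C (H.skel.ar e)) : HGraph C r :=
  H.subst (Function.update (fun e' => handle (H.lab e')) e G)

/-- The types of the hypergraph Lambek calculus, with their ranks, over the ranked set `Pr` of
primitive types. In `div N S d T`, which is `N ÷ D`, the hypergraph `D` has the hyperedges of `S`,
labeled by `T`, and one more hyperedge, with attachment nodes `d`, which is the only one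
that is labeled by the dollar sign. `prod S T` is `×(M)` for the hypergraph `M` with the
skeleton `S` and the labels `T`. Both may have no nodes and no (further) hyperedges. -/
inductive Tp (Pr : ℕ → Type) : ℕ → Type
  | prim {r : ℕ} (p : Pr r) : Tp Pr r
  | div {q r n k : ℕ} (N : Tp Pr r) (S : Skeleton (Fin n) (Fin k) r) (d : Fin q ↪ Fin n)
      (T : ∀ i, Tp Pr (S.ar i)) : Tp Pr q
  | prod {r n k : ℕ} (S : Skeleton (Fin n) (Fin k) r) (T : ∀ i, Tp Pr (S.ar i)) : Tp Pr r

/-- The type does not contain `×`, at any depth. -/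
def Tp.ProdFree {Pr : ℕ → Type} : ∀ {r : ℕ}, Tp Pr r → Prop
  | _, .prim _ => True
  | _, .div N _ _ T => N.ProdFree ∧ ∀ i, (T i).ProdFree
  | _, .prod _ _ => False

/-- Two types are the same when isomorphic hypergraphs are not distinguished. -/
inductive Tp.Same {Pr : ℕ → Type} : ∀ {r : ℕ}, Tp Pr r → Tp Pr r → Prop
  | prim {r : ℕ} (p : Pr r) : Tp.Same (Tp.prim p) (Tp.prim p)
  | div {q r n k n' k' : ℕ} {N N' : Tp Pr r}
      {S : Skeleton (Fin n) (Fin k) r} {S' : Skeleton (Fin n') (Fin k') r}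
      {d : Fin q ↪ Fin n} {d' : Fin q ↪ Fin n'}
      {T : ∀ i, Tp Pr (S.ar i)} {T' : ∀ i, Tp Pr (S'.ar i)}
      (hN : Tp.Same N N') (f : Skeleton.Iso S S') (hd : ∀ i, d' i = f.node (d i))
      (hT : ∀ i, Tp.Same (T i) (f.ar_eq i ▸ T' (f.edge i))) :
      Tp.Same (Tp.div N S d T) (Tp.div N' S' d' T')
  | prod {r n k n' k' : ℕ}
      {S : Skeleton (Fin n) (Fin k) r} {S' : Skeleton (Fin n') (Fin k') r}
      {T : ∀ i, Tp Pr (S.ar i)} {T' : ∀ i, Tp Pr (S'.ar i)}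
      (f : Skeleton.Iso S S') (hT : ∀ i, Tp.Same (T i) (f.ar_eq i ▸ T' (f.edge i))) :
      Tp.Same (Tp.prod S T) (Tp.prod S' T')

section Replace

variable {C : ℕ → Type} {n k r q : ℕ}

/-- `D[d₀/G, d₁/H₁, …, d_k/H_k]` for a hypergraph `D` with a distinguished hyperedge `d₀`
(attached to `d`) and the other hyperedges `d₁, …, d_k` (those of `S`). -/
noncomputable def denomSubst (S : Skeleton (Fin n) (Fin k) r) (d : Fin q ↪ Fin n)
    (G : HGraph C q) (H : ∀ i, HGraph C (S.ar i)) : HGraph C r :=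
  (S.insertEdge d).subst (fun e => match e with
    | none => G
    | some i => H i)

/-- The hypergraph with skeleton `S` and labels `T`. -/
abbrev ofLabels (S : Skeleton (Fin n) (Fin k) r) (T : ∀ i, C (S.ar i)) : HGraph C r where
  V := Fin n
  E := Fin k
  finV := inferInstance
  finE := inferInstance
  skel := S
  lab := T

end Replace

/-- Derivability in `HL` of the sequent `H → A`. The clause `iso` expresses that isomorphic
hypergraphs are not distinguished, neither as antecedents nor inside types. The other clauses are
the axiom and the rules. In `divLeft`, the hyperedge `e` of `H` is labeled by `N = H.lab e` and
`H[e/D][d₀ := N ÷ D][d₁/H₁, …, d_k/H_k]` is written as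
`H[e / D[d₀/(N ÷ D)•, d₁/H₁, …, d_k/H_k]]`, the order of replacements being immaterial. -/
inductive Derivable {Pr : ℕ → Type} : ∀ {r : ℕ}, HGraph (Tp Pr) r → Tp Pr r → Prop
  | iso {r : ℕ} {H H' : HGraph (Tp Pr) r} {A A' : Tp Pr r} :
      HGraph.IsoUpTo Tp.Same H H' → Tp.Same A A' → Derivable H A → Derivable H' A'
  | ax {r : ℕ} (p : Pr r) : Derivable (handle (Tp.prim p)) (Tp.prim p)
  | divLeft {r q n k : ℕ} (H : HGraph (Tp Pr) r) (A : Tp Pr r) (e : H.E)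
      (S : Skeleton (Fin n) (Fin k) (H.skel.ar e)) (d : Fin q ↪ Fin n)
      (T : ∀ i, Tp Pr (S.ar i)) (Hs : ∀ i, HGraph (Tp Pr) (S.ar i)) :
      Derivable H A → (∀ i, Derivable (Hs i) (T i)) →
      Derivable (H.replace e (denomSubst S d (handle (Tp.div (H.lab e) S d T)) Hs)) A
  | divRight {r q n k : ℕ} (F : HGraph (Tp Pr) q) (N : Tp Pr r)
      (S : Skeleton (Fin n) (Fin k) r) (d : Fin q ↪ Fin n) (T : ∀ i, Tp Pr (S.ar i)) :
      Derivable (denomSubst S d F (fun i => handle (T i))) N →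
      Derivable F (Tp.div N S d T)
  | prodLeft {r n k : ℕ} (G : HGraph (Tp Pr) r) (A : Tp Pr r) (e : G.E)
      (S : Skeleton (Fin n) (Fin k) (G.skel.ar e)) (T : ∀ i, Tp Pr (S.ar i)) :
      G.lab e = Tp.prod S T → Derivable (G.replace e (ofLabels S T)) A → Derivable G A
  | prodRight {r n k : ℕ} (S : Skeleton (Fin n) (Fin k) r) (T : ∀ i, Tp Pr (S.ar i))
      (Hs : ∀ i, HGraph (Tp Pr) (S.ar i)) :
      (∀ i, Derivable (Hs i) (T i)) → Derivable (S.subst Hs) (Tp.prod S T)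

/-- A valuation of the primitive types in the alphabet `Sg`: it assigns to each primitive type a
language of hypergraphs of the same rank, that is, a set of such hypergraphs that does not
distinguish isomorphic ones. -/
structure Valuation (Pr Sg : ℕ → Type) where
  lang : ∀ {r : ℕ}, Pr r → Set (HGraph Sg r)
  isom_mem : ∀ {r : ℕ} (p : Pr r) {G G' : HGraph Sg r}, G.Isom G' → G ∈ lang p → G' ∈ lang p

/-- The extension of a valuation to all types. -/
def Valuation.val {Pr Sg : ℕ → Type} (w : Valuation Pr Sg) :
    ∀ {r : ℕ}, Tp Pr r → Set (HGraph Sg r)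
  | _, .prim p => w.lang p
  | _, .div N S d T => {G | ∀ H : ∀ i, HGraph Sg (S.ar i), (∀ i, H i ∈ w.val (T i)) →
      denomSubst S d G H ∈ w.val N}
  | _, .prod S T => {G | ∃ H : ∀ i, HGraph Sg (S.ar i), (∀ i, H i ∈ w.val (T i)) ∧
      (S.subst H).Isom G}

/-- The language of `×(H)`. -/
def Valuation.valGraph {Pr Sg : ℕ → Type} (w : Valuation Pr Sg) {r : ℕ} (H : HGraph (Tp Pr) r) :
    Set (HGraph Sg r) :=
  {G | ∃ F : ∀ e, HGraph Sg (H.skel.ar e), (∀ e, F e ∈ w.val (H.lab e)) ∧ (H.subst F).Isom G}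

/-- The sequent `H → A` is true under the valuation `w`. -/
def Valuation.Holds {Pr Sg : ℕ → Type} (w : Valuation Pr Sg) {r : ℕ} (H : HGraph (Tp Pr) r)
    (A : Tp Pr r) : Prop :=
  w.valGraph H ⊆ w.val A

end HL

namespace HL

/-! A canonical model refutes every underivable sequent: the letters are the types themselves, and a
primitive `p` denotes the set of all `G` with `G → p` derivable. By induction on a product-free `A`,
the handle of `A` lies in the language of `A`, and every hypergraph `G` in that language has `G → A`
derivable (`canonical_handle_mem_and_derivable`). For a sequent `H → A`, replacing each hyperedge of
`H` by its own handle gives back `H`; hence `H` lies in the language of `×(H)`, so in that of `A`,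
and `H → A` is derivable. The key point is that every language of the model is closed under `(÷→)`
(`canonical_divLeft`). This needs replacement to be associative up to isomorphism
(`Skeleton.subst_assoc`). -/

theorem eq_rec_of_heq {C : ℕ → Type} {n m : ℕ} (h : m = n) {a : C n} {b : C m}
    (hab : HEq a b) : a = h ▸ b := by
  subst h
  exact eq_of_heq hab

theorem heq_of_eq_rec {C : ℕ → Type} {n m : ℕ} (h : m = n) {a : C n} {b : C m}
    (hab : a = h ▸ b) : HEq a b := by
  subst h
  exact heq_of_eq hab

theorem HGraph.Isom.refl {C : ℕ → Type} {r : ℕ} (G : HGraph C r) : G.Isom G :=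
  ⟨⟨Equiv.refl _, Equiv.refl _, fun _ => rfl, fun _ _ => rfl, fun _ => rfl⟩, fun _ => rfl⟩

/-! ### Hyperedge replacement up to isomorphism -/

section Glue

variable {C : ℕ → Type} {V E : Type} {r : ℕ}

theorem substNode_of_not_ext (S : Skeleton V E r) (F : ∀ e, HGraph C (S.ar e)) (e : E)
    (v : (F e).V) (h : ¬ ∃ i, (F e).skel.ext i = v) :
    substNode S F e v = Sum.inr ⟨e, v, h⟩ := by
  unfold substNode
  rw [dif_neg h]

theorem substNode_eq_inl (S : Skeleton V E r) (F : ∀ e, HGraph C (S.ar e)) {e : E}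
    {v : (F e).V} {w : V} (h : substNode S F e v = Sum.inl w) :
    ∃ i, (F e).skel.ext i = v := by
  by_contra hv
  rw [substNode_of_not_ext S F e v hv] at h
  cases h

theorem substNode_eq_substNode (S : Skeleton V E r) (F : ∀ e, HGraph C (S.ar e)) {e e' : E}
    {v : (F e).V} {v' : (F e').V} (hv : ¬ ∃ i, (F e).skel.ext i = v)
    (h : substNode S F e v = substNode S F e' v') : e = e' := by
  rw [substNode_of_not_ext S F e v hv] at h
  by_cases hv' : ∃ i, (F e').skel.ext i = v'
  · obtain ⟨i, rfl⟩ := hv'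
    rw [substNode_ext] at h
    cases h
  · rw [substNode_of_not_ext S F e' v' hv'] at h
    exact congrArg Sigma.fst (Sum.inr.inj h)

theorem exists_substNode_of_inr (S : Skeleton V E r) (F : ∀ e, HGraph C (S.ar e))
    (x : Σ e : E, {v : (F e).V // ¬ ∃ i, (F e).skel.ext i = v}) :
    substNode S F x.1 x.2.1 = Sum.inr x :=
  substNode_of_not_ext S F x.1 x.2.1 x.2.2

/-- Criterion for a hypergraph to be the result of a replacement: it is glued together from the
images of the host and of the replacing hypergraphs. -/
theorem isom_of_glue [Finite V] [Finite E] (S : Skeleton V E r) (F : ∀ e, HGraph C (S.ar e))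
    (G : HGraph C r) (a : V → G.V) (b : ∀ e, (F e).V → G.V) (c : (Σ e, (F e).E) ≃ G.E)
    (ha : Function.Injective a) (hb : ∀ e, Function.Injective (b e))
    (hba : ∀ e i, b e ((F e).skel.ext i) = a (S.att e i))
    (hext : ∀ e v w, b e v = a w → ∃ i, (F e).skel.ext i = v)
    (hbb : ∀ e e' v v', (¬ ∃ i, (F e).skel.ext i = v) → b e v = b e' v' → e = e')
    (hsurj : ∀ x, (∃ w, a w = x) ∨ ∃ e v, b e v = x)
    (har : ∀ e x, G.skel.ar (c ⟨e, x⟩) = (F e).skel.ar x)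
    (hatt : ∀ e x i, G.skel.att (c ⟨e, x⟩) (Fin.cast (har e x).symm i) =
      b e ((F e).skel.att x i))
    (hGext : ∀ i, G.skel.ext i = a (S.ext i))
    (hlab : ∀ e x, HEq ((F e).lab x) (G.lab (c ⟨e, x⟩))) :
    (S.subst F).Isom G := by
  -- The candidate node bijection. `hba` makes it agree with `b` on fused nodes as well; `hext` and
  -- `hbb` exclude collisions between host and inner nodes and between inner nodes of different
  -- copies.
  let φ : SubstNode S F → G.V := Sum.elim a (fun x => b x.1 x.2.1)
  have hφ : ∀ e v, φ (substNode S F e v) = b e v := by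
    intro e v
    by_cases hv : ∃ i, (F e).skel.ext i = v
    · obtain ⟨i, rfl⟩ := hv
      rw [substNode_ext, hba]
      rfl
    · rw [substNode_of_not_ext S F e v hv]
      rfl
  have hbij : Function.Bijective φ := by
    constructor
    · rintro (v | ⟨e, v, hv⟩) (v' | ⟨e', v', hv'⟩) h
      · exact congrArg Sum.inl (ha h)
      · exact absurd (hext e' v' v h.symm) hv'
      · exact absurd (hext e v v' h) hv
      · obtain rfl : e = e' := hbb e e' v v' hv h
        obtain rfl : v = v' := hb e h
        rfl
    · intro x
      obtain ⟨w, rfl⟩ | ⟨e, v, rfl⟩ := hsurj x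
      · exact ⟨Sum.inl w, rfl⟩
      · exact ⟨substNode S F e v, hφ e v⟩
  refine ⟨⟨Equiv.ofBijective φ hbij, c, fun x => har x.1 x.2, ?_, hGext⟩, ?_⟩
  · rintro ⟨e, x⟩ i
    exact (hatt e x i).trans (hφ e _).symm
  · rintro ⟨e, x⟩
    exact eq_rec_of_heq _ (hlab e x)

theorem Skeleton.subst_congr [Finite V] [Finite E] (S : Skeleton V E r)
    (F F' : ∀ e, HGraph C (S.ar e)) (h : ∀ e, (F e).Isom (F' e)) :
    (S.subst F).Isom (S.subst F') := by
  choose f hf using h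
  have hne : ∀ e v, (¬ ∃ i, (F e).skel.ext i = v) →
      ¬ ∃ i, (F' e).skel.ext i = (f e).node v := by
    rintro e v hv ⟨i, hi⟩
    rw [(f e).ext_eq] at hi
    exact hv ⟨i, (f e).node.injective hi⟩
  refine isom_of_glue S F (S.subst F') Sum.inl (fun e v => substNode S F' e ((f e).node v))
    (Equiv.sigmaCongrRight fun e => (f e).edge) Sum.inl_injective
    (fun e => (substNode_injective S F' e).comp (f e).node.injective) ?_ ?_ ?_ ?_
    (fun e x => (f e).ar_eq x) ?_ (fun _ => rfl) (fun e x => heq_of_eq_rec _ (hf e x))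
  · intro e i
    rw [← (f e).ext_eq]
    exact substNode_ext S F' e i
  · intro e v w h
    by_contra hv
    exact hne e v hv (substNode_eq_inl S F' h)
  · intro e e' v v' hv h
    exact substNode_eq_substNode S F' (hne e v hv) h
  · rintro (w | x)
    · exact Or.inl ⟨w, rfl⟩
    · refine Or.inr ⟨x.1, (f x.1).node.symm x.2.1, ?_⟩
      rw [Equiv.apply_symm_apply]
      exact exists_substNode_of_inr S F' x
  · intro e x i
    exact congrArg (substNode S F' e) ((f e).att_eq x i)

/-- All nodes of a handle are external, so fusing leaves no new nodes. -/
theorem HGraph.subst_handle (H : HGraph C r) :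
    (H.subst fun e => handle (H.lab e)).Isom H := by
  have := H.finV
  have := H.finE
  refine isom_of_glue H.skel (fun e => handle (H.lab e)) H id (fun e => H.skel.att e)
    (Equiv.sigmaPUnit _) Function.injective_id (fun e => (H.skel.att e).injective)
    (fun _ _ => rfl) (fun _ v _ _ => ⟨v, rfl⟩) (fun _ _ v _ hv => absurd ⟨v, rfl⟩ hv)
    (fun x => Or.inl ⟨x, rfl⟩) (fun _ _ => rfl) (fun _ _ _ => rfl) (fun _ => rfl)
    (fun _ _ => HEq.rfl)

theorem handle_subst {C' : ℕ → Type} (l : C' r) (K : HGraph C r) :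
    ((handle l).subst fun _ => K).Isom K := by
  refine isom_of_glue (handle l).skel (fun _ => K) K K.skel.ext (fun _ => id)
    (Equiv.uniqueSigma _) K.skel.ext.injective (fun _ => Function.injective_id)
    (fun _ _ => rfl) (fun _ _ w h => ⟨w, h.symm⟩) (fun _ _ _ _ _ _ => rfl)
    (fun x => Or.inr ⟨(), x, rfl⟩) (fun _ _ => rfl) (fun _ _ _ => rfl) (fun _ => rfl)
    (fun _ _ => HEq.rfl)

theorem handle_replace (l : C r) (K : HGraph C r) :
    ((handle l).replace () K).Isom K := by
  have h : ((handle l).replace () K) = (handle l).subst fun _ => K := by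
    unfold HGraph.replace
    congr 1
    funext x
    exact dif_pos rfl
  rw [h]
  exact handle_subst l K

/-- Either side has three kinds of nodes: those of `S`, inner nodes of the `F e` and inner nodes of
the `K x`. Only the nesting of the disjoint unions differs. -/
theorem Skeleton.subst_assoc {C' : ℕ → Type} [Finite V] [Finite E] (S : Skeleton V E r)
    (F : ∀ e, HGraph C' (S.ar e)) (K : ∀ x : (S.subst F).E, HGraph C ((S.subst F).skel.ar x)) :
    ((S.subst F).subst K).Isom (S.subst fun e => (F e).subst fun x => K ⟨e, x⟩) := by
  have := (S.subst F).finV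
  have := (S.subst F).finE
  let L : ∀ e, HGraph C (S.ar e) := fun e => (F e).subst fun x => K ⟨e, x⟩
  have hL : ∀ e v, (¬ ∃ i, (F e).skel.ext i = v) →
      ¬ ∃ i, (L e).skel.ext i = (Sum.inl v : (L e).V) := by
    rintro e v hv ⟨i, hi⟩
    exact hv ⟨i, Sum.inl.inj hi⟩
  -- `a` embeds the host `S.subst F`, keeping the nodes of `S` and sending an inner node of `F e`
  -- into the copy of `L e`; `b` embeds `K ⟨e, x⟩` through `L e`.
  let a : SubstNode S F → SubstNode S L :=
    Sum.elim Sum.inl (fun x => substNode S L x.1 (Sum.inl x.2.1))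
  let b : ∀ x : (S.subst F).E, (K x).V → SubstNode S L := fun x v =>
    substNode S L x.1 (substNode (F x.1).skel (fun y => K ⟨x.1, y⟩) x.2 v)
  let c : (Σ x : (Σ e, (F e).E), (K x).E) ≃ Σ e, Σ x, (K ⟨e, x⟩).E :=
    ⟨fun z => ⟨z.1.1, z.1.2, z.2⟩, fun z => ⟨⟨z.1, z.2.1⟩, z.2.2⟩, fun _ => rfl, fun _ => rfl⟩
  have haF : ∀ e v, a (substNode S F e v) = substNode S L e (Sum.inl v) := by
    intro e v
    by_cases hv : ∃ i, (F e).skel.ext i = v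
    · obtain ⟨i, rfl⟩ := hv
      rw [substNode_ext]
      exact (substNode_ext S L e i).symm
    · rw [substNode_of_not_ext S F e v hv]
      rfl
  have hLe : ∀ e x v, (¬ ∃ i, (K ⟨e, x⟩).skel.ext i = v) →
      ¬ ∃ i, (L e).skel.ext i = substNode (F e).skel (fun y => K ⟨e, y⟩) x v := by
    rintro e x v hv ⟨i, hi⟩
    exact hv (substNode_eq_inl (F e).skel (fun y => K ⟨e, y⟩) hi.symm)
  refine isom_of_glue (S.subst F).skel K (S.subst L) a b c ?_ ?_ ?_ ?_ ?_ ?_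
    (fun _ _ => rfl) (fun _ _ _ => rfl) (fun _ => rfl) (fun _ _ => HEq.rfl)
  · rintro (v | ⟨e, v, hv⟩) (v' | ⟨e', v', hv'⟩) h
    · exact congrArg Sum.inl (Sum.inl.inj h)
    · exact absurd (substNode_eq_inl S L h.symm) (hL e' v' hv')
    · exact absurd (substNode_eq_inl S L h) (hL e v hv)
    · obtain rfl : e = e' := substNode_eq_substNode S L (hL e v hv) h
      obtain rfl : v = v' := Sum.inl.inj (substNode_injective S L e h)
      rfl
  · intro x
    exact (substNode_injective S L x.1).comp
      (substNode_injective (F x.1).skel (fun y => K ⟨x.1, y⟩) x.2)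
  · rintro ⟨e, x⟩ i
    refine (congrArg (substNode S L e)
      (substNode_ext (F e).skel (fun y => K ⟨e, y⟩) x i)).trans ?_
    exact (haF e _).symm
  · rintro ⟨e, x⟩ v w h
    by_contra hv
    rcases w with w | ⟨e', w, hw⟩
    · exact hLe e x v hv (substNode_eq_inl S L h)
    · obtain rfl : e = e' := substNode_eq_substNode S L (hLe e x v hv) h
      exact hv (substNode_eq_inl (F e).skel (fun y => K ⟨e, y⟩) (substNode_injective S L e h))
  · rintro ⟨e, x⟩ ⟨e', x'⟩ v v' hv h
    obtain rfl : e = e' := substNode_eq_substNode S L (hLe e x v hv) h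
    obtain rfl : x = x' := substNode_eq_substNode (F e).skel (fun y => K ⟨e, y⟩) hv
      (substNode_injective S L e h)
    rfl
  · rintro (w | ⟨e, w | ⟨x, v, hv⟩, hw⟩)
    · exact Or.inl ⟨Sum.inl w, rfl⟩
    · exact Or.inl ⟨substNode S F e w, (haF e w).trans (substNode_of_not_ext S L e _ hw)⟩
    · refine Or.inr ⟨⟨e, x⟩, v, ?_⟩
      refine (congrArg (substNode S L e)
        (substNode_of_not_ext (F e).skel (fun y => K ⟨e, y⟩) x v hv)).trans ?_
      exact substNode_of_not_ext S L e _ hw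

end Glue

/-! ### Replacement inside a denominator -/

section Denominator

variable {C : ℕ → Type} {n k r q : ℕ}

theorem denomSubst_congr (S : Skeleton (Fin n) (Fin k) r) (d : Fin q ↪ Fin n)
    {G G' : HGraph C q} (h : G.Isom G') (H : ∀ i, HGraph C (S.ar i)) :
    (denomSubst S d G H).Isom (denomSubst S d G' H) := by
  refine Skeleton.subst_congr _ _ _ ?_
  rintro (_ | i)
  · exact h
  · exact HGraph.Isom.refl _

open Classical in
/-- Replacement inside the hypergraph that is substituted for the distinguished hyperedge, up to
the replacement of the remaining hyperedges by their handles. -/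
theorem exists_replace_denomSubst (S : Skeleton (Fin n) (Fin k) r) (d : Fin q ↪ Fin n)
    (G : HGraph C q) (H : ∀ i, HGraph C (S.ar i)) (e : G.E) (K : HGraph C (G.skel.ar e)) :
    ∃ M, ((denomSubst S d G H).replace ⟨none, e⟩ K).Isom M ∧
      M.Isom (denomSubst S d (G.replace e K) H) := by
  -- Replacing one hyperedge is a simultaneous replacement with handles elsewhere, so associativity
  -- pushes it into the components. Keeping `M` explicit avoids transitivity of `HGraph.Isom`.
  refine ⟨_, Skeleton.subst_assoc _ _ _, Skeleton.subst_congr _ _ _ ?_⟩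
  rintro (_ | i)
  · dsimp only
    have h : (fun x : G.E => Function.update
        (fun e' => handle ((denomSubst S d G H).lab e')) ⟨none, e⟩ K ⟨none, x⟩) =
        Function.update (fun e' => handle (G.lab e')) e K := by
      funext x
      by_cases hx : x = e
      · subst hx
        rw [Function.update_self]
        exact Function.update_self _ _ _
      · rw [Function.update_of_ne hx]
        refine (Function.update_of_ne ?_ _ _).trans rfl
        intro h
        exact hx (eq_of_heq (Sigma.mk.inj h).2)
    unfold HGraph.replace
    rw [← h]
    exact HGraph.Isom.refl _
  · dsimp only
    have h : (fun x : (H i).E => Function.update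
        (fun e' => handle ((denomSubst S d G H).lab e')) ⟨none, e⟩ K ⟨some i, x⟩) =
        fun x => handle ((H i).lab x) := by
      funext x
      refine (Function.update_of_ne ?_ _ _).trans rfl
      intro h
      cases (Sigma.mk.inj h).1
    have h2 := (H i).subst_handle
    rw [← h] at h2
    exact h2

end Denominator

theorem Tp.Same.refl {Pr : ℕ → Type} {r : ℕ} (A : Tp Pr r) : Tp.Same A A := by
  induction A with
  | prim p => exact .prim p
  | div N S d T hN hT =>
    exact .div hN ⟨Equiv.refl _, Equiv.refl _, fun _ => rfl, fun _ _ => rfl, fun _ => rfl⟩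
      (fun _ => rfl) hT
  | prod S T hT =>
    exact .prod ⟨Equiv.refl _, Equiv.refl _, fun _ => rfl, fun _ _ => rfl, fun _ => rfl⟩ hT

theorem Derivable.of_isom {Pr : ℕ → Type} {r : ℕ} {H H' : HGraph (Tp Pr) r} {A : Tp Pr r}
    (h : H.Isom H') (hH : Derivable H A) : Derivable H' A := by
  obtain ⟨f, hf⟩ := h
  refine Derivable.iso ⟨f, fun e => ?_⟩ (Tp.Same.refl A) hH
  have := hf e
  rw [← this]
  exact Tp.Same.refl _

theorem Valuation.val_isom {Pr Sg : ℕ → Type} (w : Valuation Pr Sg) {r : ℕ} {A : Tp Pr r}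
    (hA : A.ProdFree) {G G' : HGraph Sg r} (h : G.Isom G') (hG : G ∈ w.val A) :
    G' ∈ w.val A := by
  induction A with
  | prim p => exact w.isom_mem p h hG
  | div N S d T hN _ => exact fun H hH => hN hA.1 (denomSubst_congr S d h H) (hG H hH)
  | prod => exact hA.elim

/-! ### The canonical model -/

/-- The canonical valuation: types are the letters, and a primitive type denotes the set of all
hypergraphs from which it is derivable. -/
def canonical (Pr : ℕ → Type) : Valuation Pr (Tp Pr) where
  lang p := {G | Derivable G (.prim p)}
  isom_mem _ _ _ h hG := Derivable.of_isom h hG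

/-- For a primitive type this is the rule `(÷→)` itself. For a quotient, the rule is applied within
the copy of `H` that fills the distinguished hyperedge, where `e` becomes `⟨none, e⟩`, and the
numerator takes over. -/
theorem canonical_divLeft {Pr : ℕ → Type} {m : ℕ} {A : Tp Pr m} (hA : A.ProdFree)
    {H : HGraph (Tp Pr) m} (hH : H ∈ (canonical Pr).val A) (e : H.E) {q n k : ℕ}
    (S : Skeleton (Fin n) (Fin k) (H.skel.ar e)) (d : Fin q ↪ Fin n)
    (T : ∀ i, Tp Pr (S.ar i)) (Hs : ∀ i, HGraph (Tp Pr) (S.ar i))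
    (hHs : ∀ i, Derivable (Hs i) (T i)) :
    H.replace e (denomSubst S d (handle (Tp.div (H.lab e) S d T)) Hs) ∈
      (canonical Pr).val A := by
  induction A with
  | prim p => exact Derivable.divLeft H _ e S d T Hs hH hHs
  | div N S' d' T' hN _ =>
    intro F hF
    obtain ⟨M, h₁, h₂⟩ := exists_replace_denomSubst S' d' H F e
      (denomSubst S d (handle (Tp.div (H.lab e) S d T)) Hs)
    exact Valuation.val_isom _ hA.1 h₂ (Valuation.val_isom _ hA.1 h₁
      (hN hA.1 (hH F hF) ⟨none, e⟩ S T Hs hHs))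
  | prod => exact hA.elim

/-- The halves must be proved together: for `N ÷ D`, each half uses itself at `N` and the other half
at the labels of `D`. -/
theorem canonical_handle_mem_and_derivable {Pr : ℕ → Type} {m : ℕ} {A : Tp Pr m}
    (hA : A.ProdFree) : handle A ∈ (canonical Pr).val A ∧
      ∀ G ∈ (canonical Pr).val A, Derivable G A := by
  induction A with
  | prim p => exact ⟨Derivable.ax p, fun _ h => h⟩
  | div N S d T hN hT =>
    refine ⟨fun F hF => ?_, fun G hG => ?_⟩
    -- The required hypergraph arises from the handle of `N`, already in the language of `N`, by
    -- applying `(÷→)` to its only hyperedge.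
    · exact Valuation.val_isom _ hA.1 (handle_replace N _)
        (canonical_divLeft hA.1 (hN hA.1).1 () S d T F fun i => (hT i (hA.2 i)).2 _ (hF i))
    · exact Derivable.divRight G N S d T
        ((hN hA.1).2 _ (hG _ fun i => (hT i (hA.2 i)).1))
  | prod => exact hA.elim

end HL

theorem mainTheorem4 (Pr : ℕ → Type) [∀ n, Countable (Pr n)] [∀ n, Infinite (Pr n)]
    {r : ℕ} (H : HL.HGraph (HL.Tp Pr) r) (A : HL.Tp Pr r)
    (hH : ∀ e : H.E, (H.lab e).ProdFree) (hA : A.ProdFree)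
    (hval : ∀ (Sg : ℕ → Type) (w : HL.Valuation Pr Sg), w.Holds H A) :
    HL.Derivable H A :=
  (HL.canonical_handle_mem_and_derivable hA).2 H (hval _ (HL.canonical Pr)
    ⟨fun e => HL.handle (H.lab e), fun e => (HL.canonical_handle_mem_and_derivable (hH e)).1,
      H.subst_handle⟩)
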